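/- Let $p$ be a prime, $q=p^e$ with $e\ge 1$, let $\sigma:\alpha\mapsto\alpha^p$ be the Frobenius automorphism of $\mathbb{F}_q$ (extended coordinatewise to words and coefficientwise to polynomials and polynomial matrices), and let $0\le\kappa<e$ with $e\mid 4\kappa$. Put $\upsilon=\gcd(e,2\kappa)$, so that $\mathbb{F}_{p^\upsilon}\subseteq\mathbb{F}_q$. Let $m_1,\dots,m_\ell$ be positive integers, $n=m_1+\cdots+m_\ell$, and $\Lambda=(\lambda_1,\dots,\lambda_\ell)$ with $0\ne\lambda_j\in\mathbb{F}_q$. Definitions. Words in $\mathbb{F}_q^n$ are written in blocks of lengths $m_1,\dots,m_\ell$. A linear code in $\mathbb{F}_q^n$ is $\Lambda$-multi-twisted ($\Lambda$-MT) of block lengths $(m_1,\dots,m_\ell)$ if it is invariant under the map sending each block $(a_0,\dots,a_{m_j-1})$ to $(\lambda_ja_{m_j-1},a_0,\dots,a_{m_j-2})$. Identify such a code with the $\mathbb{F}_q[x]$-submodule of $\mathbb{F}_q[x]^\ell$ of all vectors $(v_1,\dots,v_\ell)$ such that the word whose $j$-th block is the coefficient list of $v_j \bmod (x^{m_j}-\lambda_j)$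 lies in the code. A generator polynomial matrix (GPM) of the code is a matrix whose rows generate this submodule; the reduced GPM is the one in Hermite normal form: $\ell\times\ell$ upper triangular $[g_{i,j}]$ with every $g_{i,i}$ monic and $\deg g_{h,i}<\deg g_{i,i}$ for $h<i$. The matrix satisfying the identical equation of an $\ell\times\ell$ GPM $\mathbf{P}$ of a $\Lambda$-MT code is the matrix $\mathbf{A}$ with $\mathbf{A}\mathbf{P}=\mathrm{diag}[x^{m_1}-\lambda_1,\dots,x^{m_\ell}-\lambda_\ell]$. With $\langle \mathbf a,\mathbf b\rangle_\kappa=\sum_i a_i\sigma^\kappa(b_i)$, the right and left $\kappa$-Galois duals of $\mathcal{C}$ are $$\mathcal{C}^{\perp_\kappa}=\{\mathbf a\mid\langle \mathbf c,\mathbf a\rangle_\kappa=0\ \forall\,\mathbf c\in\mathcal{C}\},\qquad \mathcal{C}_{\perp_\kappa}=\{\mathbf a\mid\langle \mathbf a,\mathbf c\rangle_\kappa=0\ \forall\,\mathbf c\in\mathcal{C}\},$$ and $\mathcal{C}^\perp$ is the Euclidean dual (which is MT with shift constants $1/\lambda_j$). Statement. Let $\mathcal{C}\subseteq\mathbb{F}_q^n$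 be a $\Lambda$-MT code of block lengths $(m_1,\dots,m_\ell)$ with $\lambda_j\in\mathbb{F}_{p^\upsilon}$ for all $j$. Let $\mathbf{G}$ be the reduced GPM of $\mathcal{C}$, $\mathbf{H}$ the reduced GPM of $\mathcal{C}^\perp$, and $\mathbf{B}$ the matrix satisfying the identical equation of $\mathbf{H}$, i.e. $\mathbf{B}\mathbf{H}=\mathrm{diag}[x^{m_j}-1/\lambda_j]$. 1. The following are equivalent: $\mathcal{C}^{\perp_\kappa}=\mathcal{C}_{\perp_\kappa}$; $\sigma^{2\kappa}(\mathcal{C})=\mathcal{C}$; $\mathbf{G}$ has all its entries in $\mathbb{F}_{p^\upsilon}[x]$. 2. Consider the pairs $(\mathbf{X},\mathbf{Y})$ of upper triangular $\ell\times\ell$ matrices over $\mathbb{F}_{p^\upsilon}[x]$ and $\mathbb{F}_q[x]$, respectively, such that (a) $\mathbf{Y}\sigma^{e-\kappa}(\mathbf{H})$ is a matrix over $\mathbb{F}_{p^\upsilon}[x]$ and (b) $\mathbf{X}\mathbf{Y}=\sigma^{e-\kappa}(\mathbf{B})$. For such a pair, $\deg\det\mathbf{X}$ is maximum among all such pairs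 if and only if $\deg\det\mathbf{Y}$ is minimum among all such pairs. If this is the case, then the two-sided Galois dual $\mathcal{C}^{\perp_\kappa}\cap\mathcal{C}_{\perp_\kappa}$ is an MT code of block lengths $(m_1,\dots,m_\ell)$ with shift constants $\sigma^{e-\kappa}(1/\lambda_j)$, it has $\mathbf{Y}\sigma^{e-\kappa}(\mathbf{H})$ as a GPM, and its dimension over $\mathbb{F}_q$ is $\deg\det\mathbf{X}$. Furthermore, $\mathbf{X}$ is the matrix satisfying the identical equation of $\mathbf{Y}\sigma^{e-\kappa}(\mathbf{H})$, i.e. $\mathbf{X}\,\mathbf{Y}\sigma^{e-\kappa}(\mathbf{H})=\mathrm{diag}[x^{m_j}-\sigma^{e-\kappa}(1/\lambda_j)]$. -/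

import Mathlib

open Polynomial

namespace MultiTwisted

section Words

variable {F : Type*} [Field F] {ℓ : ℕ}

/-- Words of length `n = m₁ + ⋯ + m_ℓ` over `F`, written in `ℓ` blocks; the entry at `⟨j, i⟩` is the
`i`-th coordinate (counted from `0`) of the `j`-th block. -/
abbrev Word (F : Type*) {ℓ : ℕ} (m : Fin ℓ → ℕ) : Type _ := (Σ j : Fin ℓ, Fin (m j)) → F

/-- The multi-twisted shift `T_Λ`: in each block,
`(a₀, …, a_{m-1}) ↦ (λ a_{m-1}, a₀, …, a_{m-2})`. -/
def shift (m : Fin ℓ → ℕ) (lam : Fin ℓ → F) (a : Word F m) : Word F m := fun s =>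
  if s.2.1 = 0 then lam s.1 * a ⟨s.1, ⟨m s.1 - 1, Nat.sub_lt s.2.pos Nat.one_pos⟩⟩
  else a ⟨s.1, ⟨s.2.1 - 1, lt_of_le_of_lt (Nat.sub_le _ _) s.2.2⟩⟩

/-- A linear code is `Λ`-multi-twisted if it is `T_Λ`-invariant. -/
def IsMT (m : Fin ℓ → ℕ) (lam : Fin ℓ → F) (C : Submodule F (Word F m)) : Prop :=
  ∀ a ∈ C, shift m lam a ∈ C

/-- The word attached to a vector `v` of polynomials: reduce the `j`-th entry modulo
`x ^ m_j - λ_j` and list its coefficients. -/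
noncomputable def wordOf (m : Fin ℓ → ℕ) (lam : Fin ℓ → F) (v : Fin ℓ → F[X]) : Word F m :=
  fun s => (v s.1 %ₘ (X ^ m s.1 - C (lam s.1))).coeff s.2.1

/-- The code as a subset of `F[x] ^ ℓ` (for a `Λ`-MT code, an `F[x]`-submodule containing all
`(x ^ m_j - λ_j) e_j`). -/
def polyCode (m : Fin ℓ → ℕ) (lam : Fin ℓ → F) (C : Submodule F (Word F m)) :
    Set (Fin ℓ → F[X]) :=
  {v | wordOf m lam v ∈ C}

/-- `G` is a generator polynomial matrix of `C`: its rows generate the code over `F[x]`. -/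
def IsGPM {r : ℕ} (m : Fin ℓ → ℕ) (lam : Fin ℓ → F) (C : Submodule F (Word F m))
    (G : Matrix (Fin r) (Fin ℓ) F[X]) : Prop :=
  (Submodule.span F[X] (Set.range G.row) : Set (Fin ℓ → F[X])) = polyCode m lam C

/-- Square upper triangular matrices. -/
def IsUpper (G : Matrix (Fin ℓ) (Fin ℓ) F[X]) : Prop := ∀ i j, j < i → G i j = 0

/-- The reduced GPM: the GPM in Hermite normal form. -/
def IsReducedGPM (m : Fin ℓ → ℕ) (lam : Fin ℓ → F) (C : Submodule F (Word F m))
    (G : Matrix (Fin ℓ) (Fin ℓ) F[X]) : Prop :=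
  IsGPM m lam C G ∧ IsUpper G ∧ (∀ i, (G i i).Monic) ∧
    ∀ h i, h < i → (G h i).degree < (G i i).degree

/-- The identical equation `A G = diag [x ^ m_j - λ_j]`. -/
def IdenticalEq (m : Fin ℓ → ℕ) (lam : Fin ℓ → F) (A G : Matrix (Fin ℓ) (Fin ℓ) F[X]) : Prop :=
  A * G = Matrix.diagonal fun j => X ^ m j - C (lam j)

/-- All entries of the polynomial matrix `M` have their coefficients in the subfield `K`. -/
def IsOver (K : Subfield F) (M : Matrix (Fin ℓ) (Fin ℓ) F[X]) : Prop :=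
  ∀ i j n, (M i j).coeff n ∈ K

/-- `X` and `Y` are upper triangular, over `K[x]` and `F[x]` respectively, `Y P` is over `K[x]`,
and `X Y = Q`. -/
def IsFactorPair (K : Subfield F) (P Q X Y : Matrix (Fin ℓ) (Fin ℓ) F[X]) : Prop :=
  IsUpper X ∧ IsUpper Y ∧ IsOver K X ∧ IsOver K (Y * P) ∧ X * Y = Q

/-- The Euclidean dual. -/
def euclideanDual {m : Fin ℓ → ℕ} (C : Submodule F (Word F m)) : Submodule F (Word F m) where
  carrier := {a | ∀ c ∈ C, ∑ s, a s * c s = 0}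
  zero_mem' := by intro c _; simp
  add_mem' := by
    intro a b ha hb c hc
    simp [add_mul, Finset.sum_add_distrib, ha c hc, hb c hc]
  smul_mem' := by
    intro r a ha c hc
    simp [mul_assoc, ← Finset.mul_sum, ha c hc]

variable (p : ℕ) [ExpChar F p]

/-- `σ ^ μ` on words, `σ` being the Frobenius automorphism `α ↦ α ^ p`. -/
def frobWord {m : Fin ℓ → ℕ} (μ : ℕ) (a : Word F m) : Word F m :=
  fun s => iterateFrobenius F p μ (a s)

/-- `σ ^ μ` on polynomial matrices (applied to all coefficients). -/
noncomputable def frobMatrix (μ : ℕ) (M : Matrix (Fin ℓ) (Fin ℓ) F[X]) :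
    Matrix (Fin ℓ) (Fin ℓ) F[X] :=
  M.map (Polynomial.map (iterateFrobenius F p μ))

/-- The `κ`-Galois inner product `∑ a_s σ ^ κ (b_s)`. -/
def galoisInner {m : Fin ℓ → ℕ} (κ : ℕ) (a b : Word F m) : F :=
  ∑ s, a s * iterateFrobenius F p κ (b s)

/-- The right `κ`-Galois dual: all `a` with `⟨c, a⟩_κ = 0` for all `c ∈ C`. -/
def rightDual {m : Fin ℓ → ℕ} (κ : ℕ) (C : Submodule F (Word F m)) :
    Submodule F (Word F m) where
  carrier := {a | ∀ c ∈ C, galoisInner p κ c a = 0}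
  zero_mem' := by intro c _; simp [galoisInner]
  add_mem' := by
    intro a b ha hb c hc
    have h1 := ha c hc
    have h2 := hb c hc
    simp only [galoisInner] at h1 h2 ⊢
    simp only [Pi.add_apply, map_add, mul_add, Finset.sum_add_distrib, h1, h2, add_zero]
  smul_mem' := by
    intro r a ha c hc
    have h1 := ha c hc
    simp only [galoisInner] at h1 ⊢
    have h2 : ∀ s, c s * iterateFrobenius F p κ ((r • a) s) =
        iterateFrobenius F p κ r * (c s * iterateFrobenius F p κ (a s)) := by
      intro s
      simp only [Pi.smul_apply, smul_eq_mul, map_mul, mul_left_comm]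
    simp only [h2, ← Finset.mul_sum, h1, mul_zero]

/-- The left `κ`-Galois dual: all `a` with `⟨a, c⟩_κ = 0` for all `c ∈ C`. -/
def leftDual {m : Fin ℓ → ℕ} (κ : ℕ) (C : Submodule F (Word F m)) :
    Submodule F (Word F m) where
  carrier := {a | ∀ c ∈ C, galoisInner p κ a c = 0}
  zero_mem' := by intro c _; simp [galoisInner]
  add_mem' := by
    intro a b ha hb c hc
    have h1 := ha c hc
    have h2 := hb c hc
    simp only [galoisInner] at h1 h2 ⊢
    simp only [Pi.add_apply, add_mul, Finset.sum_add_distrib, h1, h2, add_zero]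
  smul_mem' := by
    intro r a ha c hc
    have h1 := ha c hc
    simp only [galoisInner] at h1 ⊢
    simp only [Pi.smul_apply, smul_eq_mul, mul_assoc, ← Finset.mul_sum, h1, mul_zero]

end Words

end MultiTwisted

namespace MultiTwisted

/-! ### Upper triangular polynomial matrices and Hermite normal forms. -/

section Triangular

variable {F : Type*} [Field F] {ℓ : ℕ}

/-! Put f = σ^{2κ}. Since e ∣ 4κ, f is an involution, and its fixed field is K, the subfield of
order p^υ. The right dual R is σ^{e-κ}(C^⊥), with reduced GPM P = σ^{e-κ}(H), and the left dual is
the preimage of R under f. Hence the two duals agree iff C^⊥ is f-invariant, iff C is. As f fixes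
the shift constants, uniqueness of Hermite forms (`hermite_unique`) turns invariance of C into
invariance of G, that is, into coefficients in K.

For the second part, E = R ∩ f⁻¹(R) is the largest f-invariant subcode of R. Its Hermite basis is
therefore over K, and it factors as Y₀P with a matching X₀ (`exists_isFactorPair_isGPM`).
Conversely, if YP is over K then its rows lie in E, so YP = Z Y₀P. The sum deg det X + deg det Y is
the constant deg det σ^{e-κ}(B), so maximality of deg det X forces det Z to be a unit, and YP
generates E. The dimension is deg det X because E is the row space of YP modulo that of XYP, which
is F[x]^ℓ modulo the rows of X (`IdenticalEq.finrank_eq`). -/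

theorem mem_span_row_iff {r : ℕ} (G : Matrix (Fin r) (Fin ℓ) F[X]) (v : Fin ℓ → F[X]) :
    v ∈ Submodule.span F[X] (Set.range G.row) ↔ ∃ c, Matrix.vecMul c G = v := by
  rw [Submodule.mem_span_range_iff_exists_fun]
  simp only [Matrix.vecMul_eq_sum]
  rfl

theorem IsUpper.vecMul_apply {U : Matrix (Fin ℓ) (Fin ℓ) F[X]} (hU : IsUpper U)
    {c : Fin ℓ → F[X]} {j : Fin ℓ} (hc : ∀ k < j, c k = 0) :
    Matrix.vecMul c U j = c j * U j j := by
  rw [Matrix.vecMul, dotProduct]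
  refine Finset.sum_eq_single j (fun k _ hk => ?_) (by simp)
  rcases lt_or_gt_of_ne hk with h | h
  · simp [hc k h]
  · simp [hU k j h]

/-- A combination of the rows of a triangular matrix whose first `t` entries are smaller than the
diagonal does not involve the first `t` rows. -/
theorem IsUpper.coeff_eq_zero {U : Matrix (Fin ℓ) (Fin ℓ) F[X]} (hU : IsUpper U)
    {c : Fin ℓ → F[X]} {t : ℕ}
    (h : ∀ j : Fin ℓ, j.1 < t → (Matrix.vecMul c U j).degree < (U j j).degree) :
    ∀ j : Fin ℓ, j.1 < t → c j = 0 := by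
  intro j
  induction j using WellFoundedLT.induction with
  | ind j ih =>
    intro hj
    have h1 := h j hj
    rw [hU.vecMul_apply fun k hk => ih k hk (lt_trans hk hj), degree_mul] at h1
    by_contra hc
    have h2 : (0 : WithBot ℕ) ≤ (c j).degree := zero_le_degree_iff.2 hc
    have h3 := add_le_add_left h2 (U j j).degree
    rw [zero_add] at h3
    exact absurd h1 (not_lt.2 h3)

/-- Uniqueness of remainders: a vector of the row space that is already reduced against the diagonal
is a trivial combination. -/
theorem IsUpper.vecMul_injective {U : Matrix (Fin ℓ) (Fin ℓ) F[X]} (hU : IsUpper U)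
    {c : Fin ℓ → F[X]}
    (h : ∀ j, (Matrix.vecMul c U j).degree < (U j j).degree) : c = 0 := by
  funext j
  exact hU.coeff_eq_zero (t := ℓ) (fun j _ => h j) j j.2

theorem IsUpper.vecMul_cancel {U : Matrix (Fin ℓ) (Fin ℓ) F[X]} (hU : IsUpper U)
    (hd : ∀ j, U j j ≠ 0) {c d : Fin ℓ → F[X]}
    (h : Matrix.vecMul c U = Matrix.vecMul d U) : c = d := by
  rw [← sub_eq_zero]
  refine hU.vecMul_injective fun j => ?_
  rw [Matrix.sub_vecMul, h, sub_self, Pi.zero_apply, degree_zero, bot_lt_iff_ne_bot]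
  exact fun h0 => hd j (degree_eq_bot.1 h0)

/-- A left factor of an upper triangular matrix is upper triangular if the right factor is. -/
theorem IsUpper.of_mul {A U : Matrix (Fin ℓ) (Fin ℓ) F[X]} (hU : IsUpper U)
    (hd : ∀ j, U j j ≠ 0) (hAU : IsUpper (A * U)) : IsUpper A := by
  intro i
  refine fun j hj => hU.coeff_eq_zero (c := A i) (t := i.1) (fun k hk => ?_) j hj
  have h0 : Matrix.vecMul (A i) U k = 0 := hAU i k hk
  rw [h0, degree_zero, bot_lt_iff_ne_bot]
  exact fun h0 => hd k (degree_eq_bot.1 h0)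

theorem IsUpper.mul {A U : Matrix (Fin ℓ) (Fin ℓ) F[X]} (hA : IsUpper A) (hU : IsUpper U) :
    IsUpper (A * U) :=
  Matrix.BlockTriangular.mul (b := id) hA hU

theorem IsUpper.det_eq {U : Matrix (Fin ℓ) (Fin ℓ) F[X]} (hU : IsUpper U) :
    U.det = ∏ j, U j j :=
  Matrix.det_of_isUpperTriangular (M := U) hU

/-- Division with remainder by the rows of an upper triangular matrix. -/
theorem IsUpper.exists_degree_sub_vecMul_lt {U : Matrix (Fin ℓ) (Fin ℓ) F[X]} (hU : IsUpper U)
    (hd : ∀ j, U j j ≠ 0) (w : Fin ℓ → F[X]) :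
    ∃ c, ∀ j, ((w - Matrix.vecMul c U) j).degree < (U j j).degree := by
  suffices H : ∀ t : ℕ, ∃ c : Fin ℓ → F[X], ∀ j : Fin ℓ, j.1 < t →
      ((w - Matrix.vecMul c U) j).degree < (U j j).degree by
    obtain ⟨c, hc⟩ := H ℓ
    exact ⟨c, fun j => hc j j.2⟩
  intro t
  induction t with
  | zero => exact ⟨0, fun j hj => absurd hj (Nat.not_lt_zero _)⟩
  | succ t ih =>
    obtain ⟨c, hc⟩ := ih
    by_cases ht : t < ℓ
    · set i : Fin ℓ := ⟨t, ht⟩ with hi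
      set z := (w - Matrix.vecMul c U) i with hz
      -- Row i vanishes in the columns before i, so dividing in column i keeps the reductions
      -- already made there.
      refine ⟨c + Pi.single i (z / U i i), fun j hj => ?_⟩
      have h1 : (w - Matrix.vecMul (c + Pi.single i (z / U i i)) U) j =
          (w - Matrix.vecMul c U) j - z / U i i * U i j := by
        rw [Matrix.add_vecMul, Matrix.single_vecMul]
        simp only [Pi.sub_apply, Pi.add_apply, Pi.smul_apply, smul_eq_mul, Matrix.row]
        ring
      rw [h1]
      rcases Nat.lt_succ_iff_lt_or_eq.1 hj with h | h
      · rw [hU i j h, mul_zero, sub_zero]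
        exact hc j h
      · have hji : j = i := Fin.ext h
        rw [hji, ← hz]
        have h2 : z - z / U i i * U i i = z % U i i := by
          rw [EuclideanDomain.mod_eq_sub_mul_div, mul_comm]
        rw [h2]
        exact degree_mod_lt _ (hd i)
    · exact ⟨c, fun j _ => hc j (lt_of_lt_of_le j.2 (not_lt.1 ht))⟩

/-- Hermite normal forms are determined by their row spaces. -/
theorem hermite_unique {U V : Matrix (Fin ℓ) (Fin ℓ) F[X]}
    (hU : IsUpper U) (hUm : ∀ i, (U i i).Monic)
    (hUr : ∀ h i, h < i → (U h i).degree < (U i i).degree)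
    (hV : IsUpper V) (hVm : ∀ i, (V i i).Monic)
    (hVr : ∀ h i, h < i → (V h i).degree < (V i i).degree)
    (h : Submodule.span F[X] (Set.range U.row) = Submodule.span F[X] (Set.range V.row)) :
    U = V := by
  have key : ∀ {U V : Matrix (Fin ℓ) (Fin ℓ) F[X]}, IsUpper U → IsUpper V →
      (∀ i, (V i i).Monic) →
      Submodule.span F[X] (Set.range U.row) = Submodule.span F[X] (Set.range V.row) →
      ∀ i, V i i ∣ U i i := by
    intro U V hU hV hVm h i
    have h1 : U.row i ∈ Submodule.span F[X] (Set.range V.row) :=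
      h ▸ Submodule.subset_span ⟨i, rfl⟩
    obtain ⟨c, hc⟩ := (mem_span_row_iff _ _).1 h1
    -- Row i of U starts with zeros, so only the rows of V from i on contribute, and column i sees
    -- just the diagonal entry of V.
    have h2 : ∀ k < i, c k = 0 := fun k hk =>
      hV.coeff_eq_zero (c := c) (t := i.1) (fun k hk => by
        rw [hc, Matrix.row, hU i k hk, degree_zero, bot_lt_iff_ne_bot]
        exact fun h0 => (hVm k).ne_zero (degree_eq_bot.1 h0)) k hk
    have h3 := hV.vecMul_apply h2
    rw [hc] at h3
    exact ⟨c i, by rw [mul_comm]; exact h3⟩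
  have hdiag : ∀ i, U i i = V i i := fun i =>
    eq_of_monic_of_associated (hUm i) (hVm i)
      (associated_of_dvd_dvd (key hV hU hUm h.symm i) (key hU hV hVm h i))
  have hrow : ∀ i, U.row i - V.row i = 0 := by
    intro i
    have h1 : U.row i - V.row i ∈ Submodule.span F[X] (Set.range U.row) :=
      sub_mem (Submodule.subset_span ⟨i, rfl⟩) (h ▸ Submodule.subset_span ⟨i, rfl⟩)
    obtain ⟨c, hc⟩ := (mem_span_row_iff _ _).1 h1
    -- With equal diagonals, the difference of the two rows is reduced in every column.
    have hc0 : c = 0 := by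
      refine hU.vecMul_injective fun j => ?_
      rw [hc, Pi.sub_apply, Matrix.row, Matrix.row]
      have hbot : (⊥ : WithBot ℕ) < (U j j).degree :=
        bot_lt_iff_ne_bot.2 fun h0 => (hUm j).ne_zero (degree_eq_bot.1 h0)
      rcases lt_trichotomy i j with hij | hij | hij
      · refine lt_of_le_of_lt (degree_sub_le _ _) (max_lt (hUr i j hij) ?_)
        rw [hdiag]
        exact hVr i j hij
      · subst hij
        rw [hdiag, sub_self, degree_zero, ← hdiag]
        exact hbot
      · rw [hU i j hij, hV i j hij, sub_zero, degree_zero]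
        exact hbot
    rw [← hc, hc0, Matrix.zero_vecMul]
  ext1 i j
  exact sub_eq_zero.1 (congrFun (hrow i) j)

/-- A submodule of `F[x] ^ ℓ` of full rank has a basis in Hermite normal form. -/
theorem exists_hermite (N : Submodule F[X] (Fin ℓ → F[X])) (q : Fin ℓ → F[X])
    (hq : ∀ j, q j ≠ 0) (hqN : ∀ j, Pi.single j (q j) ∈ N) :
    ∃ M : Matrix (Fin ℓ) (Fin ℓ) F[X],
      Submodule.span F[X] (Set.range M.row) = N ∧ IsUpper M ∧ (∀ i, (M i i).Monic) ∧
        ∀ h i, h < i → (M h i).degree < (M i i).degree := by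
  have hlead : ∀ i : Fin ℓ, ∃ u ∈ N, (∀ j < i, u j = 0) ∧ (u i).Monic ∧
      ∀ v ∈ N, (∀ j < i, v j = 0) → u i ∣ v i := by
    intro i
    -- The i-th entries of the vectors of N that vanish before i form an ideal, nonzero because it
    -- contains q i; its monic generator will be the diagonal entry.
    let I : Ideal F[X] :=
      { carrier := {f | ∃ v ∈ N, (∀ j < i, v j = 0) ∧ v i = f}
        zero_mem' := ⟨0, N.zero_mem, by simp, rfl⟩
        add_mem' := by
          rintro _ _ ⟨v, hv, hv0, rfl⟩ ⟨w, hw, hw0, rfl⟩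
          exact ⟨v + w, N.add_mem hv hw, fun j hj => by simp [hv0 j hj, hw0 j hj], rfl⟩
        smul_mem' := by
          rintro a _ ⟨v, hv, hv0, rfl⟩
          exact ⟨a • v, N.smul_mem a hv, fun j hj => by simp [hv0 j hj], rfl⟩ }
    have hqI : q i ∈ I := ⟨_, hqN i, fun j hj => Pi.single_eq_of_ne hj.ne _, by simp⟩
    classical
    set d := Submodule.IsPrincipal.generator I with hd
    have hd0 : d ≠ 0 := by
      intro h0
      have := (Submodule.IsPrincipal.mem_iff_generator_dvd I).1 hqI
      rw [← hd, h0, zero_dvd_iff] at this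
      exact hq i this
    have hnd : normalize d ∈ I :=
      (Submodule.IsPrincipal.mem_iff_generator_dvd I).2 (dvd_normalize_iff.2 dvd_rfl)
    obtain ⟨u, hu, hu0, hui⟩ := hnd
    refine ⟨u, hu, hu0, hui ▸ monic_normalize hd0, fun v hv hv0 => ?_⟩
    rw [hui, normalize_dvd_iff]
    exact (Submodule.IsPrincipal.mem_iff_generator_dvd I).1 ⟨v, hv, hv0, rfl⟩
  choose u huN hu0 hum hudvd using hlead
  -- Any triangular matrix with rows in N and these minimal diagonal entries generates N: a
  -- remainder is killed column by column, by divisibility against degree. This is needed both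
  -- before and after reducing the entries above the diagonal.
  have hspan : ∀ M : Matrix (Fin ℓ) (Fin ℓ) F[X], IsUpper M → (∀ i, M i i = u i i) →
      (∀ i, M i ∈ N) → Submodule.span F[X] (Set.range M.row) = N := by
    intro M hM hMd hMN
    have hle : Submodule.span F[X] (Set.range M.row) ≤ N :=
      Submodule.span_le.2 (by rintro _ ⟨i, rfl⟩; exact hMN i)
    refine le_antisymm hle fun v hv => ?_
    obtain ⟨c, hc⟩ := hM.exists_degree_sub_vecMul_lt
      (fun j => hMd j ▸ (hum j).ne_zero) v
    have hcM := (mem_span_row_iff M _).2 ⟨c, rfl⟩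
    have hr : v - Matrix.vecMul c M ∈ N := N.sub_mem hv (hle hcM)
    have hr0 : v - Matrix.vecMul c M = 0 := by
      funext j
      induction j using WellFoundedLT.induction with
      | ind j ih =>
        refine eq_zero_of_dvd_of_degree_lt (hudvd j _ hr ih) ?_
        rw [← hMd]
        exact hc j
    rw [sub_eq_zero] at hr0
    rw [hr0]
    exact hcM
  let U : Matrix (Fin ℓ) (Fin ℓ) F[X] := Matrix.of u
  have hU : IsUpper U := fun i j hj => hu0 i j hj
  have hUd : ∀ j, U j j ≠ 0 := fun j => (hum j).ne_zero
  have hUN := hspan U hU (fun _ => rfl) huN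
  have hred : ∀ i, ∃ w ∈ N, (∀ j < i, w j = 0) ∧ w i = u i i ∧
      ∀ j, i < j → (w j).degree < (u j j).degree := by
    intro i
    -- Removing the diagonal entry before dividing makes the quotient involve only the rows after i,
    -- so the diagonal survives.
    obtain ⟨c, hc⟩ := hU.exists_degree_sub_vecMul_lt hUd (u i - Pi.single i (u i i))
    have hz : ∀ j ≤ i, (u i - Pi.single i (u i i) : Fin ℓ → F[X]) j = 0 := by
      intro j hj
      rcases hj.lt_or_eq with h | rfl
      · simp [hu0 i j h, Pi.single_eq_of_ne h.ne]
      · simp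
    have hc0 : ∀ j : Fin ℓ, j.1 < i.1 + 1 → c j = 0 := hU.coeff_eq_zero fun j hj => by
      have := hc j
      rwa [Pi.sub_apply, hz j (Nat.lt_succ_iff.1 hj), zero_sub, degree_neg] at this
    have hcU : ∀ j ≤ i, Matrix.vecMul c U j = 0 := fun j hj => by
      rw [hU.vecMul_apply fun k hk => hc0 k (lt_of_lt_of_le hk (le_trans hj (Nat.le_succ _))),
        hc0 j (Nat.lt_succ_iff.2 hj), zero_mul]
    refine ⟨u i - Matrix.vecMul c U, N.sub_mem (huN i)
      (hUN ▸ (mem_span_row_iff U _).2 ⟨c, rfl⟩), fun j hj => ?_, ?_, fun j hj => ?_⟩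
    · rw [Pi.sub_apply, hu0 i j hj, hcU j hj.le, sub_zero]
    · rw [Pi.sub_apply, hcU i le_rfl, sub_zero]
    · have := hc j
      rwa [Pi.sub_apply, Pi.sub_apply, Pi.single_eq_of_ne hj.ne', sub_zero] at this
  choose w hwN hw0 hwd hwr using hred
  have hM : IsUpper (Matrix.of w : Matrix (Fin ℓ) (Fin ℓ) F[X]) := fun i j hj => hw0 i j hj
  refine ⟨Matrix.of w, hspan _ hM hwd hwN, hM, fun i => ?_, fun h i hi => ?_⟩
  · rw [Matrix.of_apply, hwd]
    exact hum i
  · rw [Matrix.of_apply, Matrix.of_apply, hwd]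
    exact hwr h i hi

end Triangular

end MultiTwisted

namespace MultiTwisted

/-! ### Words versus polynomial vectors. -/

section Words

variable {F : Type*} [Field F] {ℓ : ℕ}

theorem wordOf_add (m : Fin ℓ → ℕ) (lam : Fin ℓ → F) (v w : Fin ℓ → F[X]) :
    wordOf m lam (v + w) = wordOf m lam v + wordOf m lam w := by
  funext s
  simp [wordOf, add_modByMonic]

theorem wordOf_smul (m : Fin ℓ → ℕ) (lam : Fin ℓ → F) (a : F) (v : Fin ℓ → F[X]) :
    wordOf m lam (a • v) = a • wordOf m lam v := by
  funext s
  simp [wordOf, smul_modByMonic]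

theorem wordOf_eq_zero_iff {m : Fin ℓ → ℕ} (hm : ∀ j, 0 < m j) {lam : Fin ℓ → F}
    {v : Fin ℓ → F[X]} :
    wordOf m lam v = 0 ↔ ∀ j, X ^ m j - C (lam j) ∣ v j := by
  have hq : ∀ j, (X ^ m j - C (lam j)).Monic := fun j => monic_X_pow_sub_C _ (hm j).ne'
  constructor
  · intro h j
    rw [← modByMonic_eq_zero_iff_dvd (hq j)]
    ext n
    by_cases hn : n < m j
    · exact congrFun h ⟨j, n, hn⟩
    · rw [coeff_zero]
      refine coeff_eq_zero_of_degree_lt (lt_of_lt_of_le (degree_modByMonic_lt _ (hq j)) ?_)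
      rw [degree_X_pow_sub_C (hm j)]
      exact_mod_cast not_lt.1 hn
  · intro h
    funext s
    simp [wordOf, (modByMonic_eq_zero_iff_dvd (hq s.1)).2 (h s.1)]

theorem wordOf_surjective {m : Fin ℓ → ℕ} (hm : ∀ j, 0 < m j) (lam : Fin ℓ → F) :
    Function.Surjective (wordOf m lam) := by
  intro a
  refine ⟨fun j => ∑ i : Fin (m j), monomial i.1 (a ⟨j, i⟩), ?_⟩
  funext s
  have hdeg : (∑ i : Fin (m s.1), monomial i.1 (a ⟨s.1, i⟩)).degree <
      (X ^ m s.1 - C (lam s.1)).degree := by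
    rw [degree_X_pow_sub_C (hm s.1)]
    refine lt_of_le_of_lt (degree_sum_le _ _) ((Finset.sup_lt_iff (WithBot.bot_lt_coe _)).2 ?_)
    intro i _
    exact lt_of_le_of_lt (degree_monomial_le _ _) (by exact_mod_cast i.2)
  rw [wordOf, (modByMonic_eq_self_iff (monic_X_pow_sub_C _ (hm s.1).ne')).2 hdeg,
    finsetSum_coeff, Finset.sum_eq_single s.2]
  · simp
  · intro i _ hi
    rw [coeff_monomial, if_neg fun h => hi (Fin.ext h)]
  · simp

/-- Multiplying a remainder by x overflows only in degree m_j, where x^{m_j} is replaced by λ_j;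
this is the twisted wrap-around. -/
theorem wordOf_X_smul {m : Fin ℓ → ℕ} (hm : ∀ j, 0 < m j) (lam : Fin ℓ → F)
    (v : Fin ℓ → F[X]) :
    wordOf m lam ((X : F[X]) • v) = shift m lam (wordOf m lam v) := by
  funext ⟨j, i, hi⟩
  have hq : (X ^ m j - C (lam j)).Monic := monic_X_pow_sub_C _ (hm j).ne'
  set q := X ^ m j - C (lam j) with hqdef
  set r := v j %ₘ q with hr
  have hrdeg : ∀ n, m j ≤ n → r.coeff n = 0 := fun n hn => by
    refine coeff_eq_zero_of_degree_lt (lt_of_lt_of_le (degree_modByMonic_lt _ hq) ?_)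
    rw [degree_X_pow_sub_C (hm j)]
    exact_mod_cast hn
  have hcoeff0 : ∀ n, n ≠ 0 → (X * r).coeff n = r.coeff (n - 1) := fun n hn => by
    obtain ⟨k, rfl⟩ := Nat.exists_eq_succ_of_ne_zero hn
    simp [coeff_X_mul]
  set z := X * r - C (r.coeff (m j - 1)) * q with hz
  have hzc : ∀ n, z.coeff n = (X * r).coeff n -
      r.coeff (m j - 1) * ((if n = m j then 1 else 0) - if n = 0 then lam j else 0) := fun n => by
    rw [hz, coeff_sub, coeff_C_mul, hqdef, coeff_sub, coeff_X_pow, coeff_C]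
  have hzdeg : z.degree < q.degree := by
    rw [degree_X_pow_sub_C (hm j), degree_lt_iff_coeff_zero]
    intro n hn
    have hn0 : n ≠ 0 := (lt_of_lt_of_le (hm j) hn).ne'
    rw [hzc, hcoeff0 n hn0, if_neg hn0]
    rcases hn.eq_or_lt with h | h
    · rw [if_pos h.symm, ← h]
      ring
    · rw [if_neg h.ne', hrdeg _ (Nat.le_sub_one_of_lt h)]
      ring
  have hmod : (X * v j) %ₘ q = z := by
    refine (div_modByMonic_unique (X * (v j /ₘ q) + C (r.coeff (m j - 1))) z hq
      ⟨?_, hzdeg⟩).2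
    have h1 := modByMonic_add_div (v j) q
    rw [← hr] at h1
    rw [hz]
    linear_combination X * h1
  have hL : wordOf m lam ((X : F[X]) • v) ⟨j, i, hi⟩ = z.coeff i := by
    rw [← hmod]
    rfl
  rw [hL, hzc, shift]
  dsimp only
  by_cases h0 : i = 0
  · subst h0
    rw [if_pos rfl, if_pos rfl, if_neg (hm j).ne, mul_coeff_zero, coeff_X_zero]
    simp only [wordOf, ← hqdef, ← hr]
    ring
  · rw [if_neg h0, if_neg h0, hcoeff0 i h0, if_neg hi.ne]
    simp only [wordOf, ← hqdef, ← hr]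
    ring

/-- A code that has a generator polynomial matrix is multi-twisted. -/
theorem IsGPM.isMT {r : ℕ} {m : Fin ℓ → ℕ} (hm : ∀ j, 0 < m j) {lam : Fin ℓ → F}
    {D : Submodule F (Word F m)} {G : Matrix (Fin r) (Fin ℓ) F[X]} (hG : IsGPM m lam D G) :
    IsMT m lam D := by
  intro a ha
  obtain ⟨v, rfl⟩ := wordOf_surjective hm lam a
  rw [← wordOf_X_smul hm]
  have hv : v ∈ (Submodule.span F[X] (Set.range G.row) : Set (Fin ℓ → F[X])) := by
    rw [hG]
    exact ha
  have h1 : (X : F[X]) • v ∈ (Submodule.span F[X] (Set.range G.row) : Set (Fin ℓ → F[X])) :=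
    Submodule.smul_mem _ _ hv
  rw [hG] at h1
  exact h1

theorem isGPM_iff {r : ℕ} {m : Fin ℓ → ℕ} {lam : Fin ℓ → F}
    {D : Submodule F (Word F m)} {G : Matrix (Fin r) (Fin ℓ) F[X]} :
    IsGPM m lam D G ↔
      ∀ v, v ∈ Submodule.span F[X] (Set.range G.row) ↔ wordOf m lam v ∈ D :=
  Set.ext_iff

theorem IsGPM.code_unique {r : ℕ} {m : Fin ℓ → ℕ} (hm : ∀ j, 0 < m j) {lam : Fin ℓ → F}
    {D E : Submodule F (Word F m)} {G : Matrix (Fin r) (Fin ℓ) F[X]} (hD : IsGPM m lam D G)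
    (hE : IsGPM m lam E G) : D = E := by
  ext a
  obtain ⟨v, rfl⟩ := wordOf_surjective hm lam a
  rw [← isGPM_iff.1 hD, ← isGPM_iff.1 hE]

end Words

/-! ### Coefficientwise field maps acting on codes and their matrices. -/

section Maps

variable {F : Type*} [Field F] {ℓ : ℕ} (f : F →+* F)

theorem wordOf_map {m : Fin ℓ → ℕ} (hm : ∀ j, 0 < m j) (lam : Fin ℓ → F) (v : Fin ℓ → F[X]) :
    wordOf m (fun j => f (lam j)) (fun j => (v j).map f) = fun s => f (wordOf m lam v s) := by
  funext s
  have h : (X ^ m s.1 - C (f (lam s.1)) : F[X]) = (X ^ m s.1 - C (lam s.1)).map f := by simp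
  rw [wordOf, h, ← map_modByMonic _ (monic_X_pow_sub_C _ (hm s.1).ne'), coeff_map]
  rfl

theorem vecMul_map {r : ℕ} (c : Fin r → F[X]) (G : Matrix (Fin r) (Fin ℓ) F[X]) :
    Matrix.vecMul (fun i => (c i).map f) (G.map (Polynomial.map f)) =
      fun j => (Matrix.vecMul c G j).map f := by
  funext j
  simp [Matrix.vecMul, dotProduct, Polynomial.map_sum]

variable {f}

/-- Bijectivity of f lets both vectors and combination coefficients be pulled back. Relating E to D
only by membership covers images and preimages alike. -/
theorem IsGPM.map {r : ℕ} (hf : Function.Bijective f) {m : Fin ℓ → ℕ} (hm : ∀ j, 0 < m j)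
    {lam : Fin ℓ → F} {D E : Submodule F (Word F m)}
    (hDE : ∀ a : Word F m, (fun s => f (a s)) ∈ E ↔ a ∈ D)
    {G : Matrix (Fin r) (Fin ℓ) F[X]} (hG : IsGPM m lam D G) :
    IsGPM m (fun j => f (lam j)) E (G.map (Polynomial.map f)) := by
  have hsurj := Polynomial.map_surjective f hf.2
  rw [isGPM_iff]
  intro w
  obtain ⟨v, rfl⟩ : ∃ v : Fin ℓ → F[X], (fun j => (v j).map f) = w := by
    choose g hg using fun j => hsurj (w j)
    exact ⟨g, funext hg⟩
  rw [wordOf_map f hm, hDE, ← isGPM_iff.1 hG, mem_span_row_iff, mem_span_row_iff]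
  constructor
  · rintro ⟨c, hc⟩
    choose d hd using fun i => hsurj (c i)
    obtain rfl : (fun i => (d i).map f) = c := funext hd
    rw [vecMul_map] at hc
    exact ⟨d, funext fun j => Polynomial.map_injective f hf.1 (congrFun hc j)⟩
  · rintro ⟨c, rfl⟩
    exact ⟨_, vecMul_map f c G⟩

theorem IsReducedGPM.map (hf : Function.Bijective f) {m : Fin ℓ → ℕ} (hm : ∀ j, 0 < m j)
    {lam : Fin ℓ → F} {D E : Submodule F (Word F m)}
    (hDE : ∀ a : Word F m, (fun s => f (a s)) ∈ E ↔ a ∈ D)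
    {G : Matrix (Fin ℓ) (Fin ℓ) F[X]} (hG : IsReducedGPM m lam D G) :
    IsReducedGPM m (fun j => f (lam j)) E (G.map (Polynomial.map f)) := by
  obtain ⟨h1, h2, h3, h4⟩ := hG
  refine ⟨h1.map hf hm hDE, fun i j hj => ?_, fun i => (h3 i).map f, fun h i hi => ?_⟩
  · rw [Matrix.map_apply, h2 i j hj, Polynomial.map_zero]
  · rw [Matrix.map_apply, Matrix.map_apply, degree_map, degree_map]
    exact h4 h i hi

theorem IsReducedGPM.unique {m : Fin ℓ → ℕ} {lam : Fin ℓ → F} {D : Submodule F (Word F m)}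
    {G H : Matrix (Fin ℓ) (Fin ℓ) F[X]} (hG : IsReducedGPM m lam D G)
    (hH : IsReducedGPM m lam D H) : G = H :=
  hermite_unique hG.2.1 hG.2.2.1 hG.2.2.2 hH.2.1 hH.2.2.1 hH.2.2.2
    (SetLike.coe_injective (hG.1.trans hH.1.symm))

theorem IdenticalEq.map {m : Fin ℓ → ℕ} {lam : Fin ℓ → F} {A G : Matrix (Fin ℓ) (Fin ℓ) F[X]}
    (h : IdenticalEq m lam A G) (f : F →+* F) :
    IdenticalEq m (fun j => f (lam j)) (A.map (Polynomial.map f)) (G.map (Polynomial.map f)) := by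
  have h1 := congrArg (fun M => M.map (Polynomial.mapRingHom f)) h
  simp only [Matrix.map_mul] at h1
  refine h1.trans ?_
  rw [Matrix.diagonal_map (map_zero _)]
  congr 1
  funext j
  simp

theorem isOver_iff_map_eq {K : Subfield F} (hK : ∀ x, x ∈ K ↔ f x = x)
    {M : Matrix (Fin ℓ) (Fin ℓ) F[X]} : IsOver K M ↔ M.map (Polynomial.map f) = M := by
  simp only [IsOver, hK, ← Matrix.ext_iff, Matrix.map_apply, Polynomial.ext_iff, coeff_map]

/-- An invariant code is one whose reduced generator polynomial matrix is invariant. -/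
theorem IsReducedGPM.map_eq_iff (hf : Function.Bijective f) {m : Fin ℓ → ℕ} (hm : ∀ j, 0 < m j)
    {lam : Fin ℓ → F} (hlam : ∀ j, f (lam j) = lam j) {D E : Submodule F (Word F m)}
    (hDE : ∀ a : Word F m, (fun s => f (a s)) ∈ E ↔ a ∈ D)
    {G : Matrix (Fin ℓ) (Fin ℓ) F[X]} (hG : IsReducedGPM m lam D G) :
    G.map (Polynomial.map f) = G ↔ E = D := by
  have h1 := hG.map hf hm hDE
  simp only [hlam] at h1
  constructor
  · intro h
    rw [h] at h1
    exact h1.1.code_unique hm hG.1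
  · rintro rfl
    exact h1.unique hG

end Maps

end MultiTwisted

namespace MultiTwisted

/-! ### Dimension, factor pairs and the largest invariant subcode. -/

section Factorization

variable {F : Type*} [Field F] {ℓ : ℕ}

theorem det_diagonal_X_pow_sub_C_ne_zero {m : Fin ℓ → ℕ} (hm : ∀ j, 0 < m j) (lam : Fin ℓ → F) :
    (Matrix.diagonal fun j => (X ^ m j - C (lam j) : F[X])).det ≠ 0 := by
  rw [Matrix.det_diagonal]
  exact Finset.prod_ne_zero_iff.2 fun j _ => X_pow_sub_C_ne_zero (hm j) _

theorem IsUpper.diag_ne_zero {U : Matrix (Fin ℓ) (Fin ℓ) F[X]} (hU : IsUpper U)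
    (h : U.det ≠ 0) (j : Fin ℓ) : U j j ≠ 0 := by
  rw [hU.det_eq] at h
  exact Finset.prod_ne_zero_iff.1 h j (Finset.mem_univ j)

theorem wordOf_eq_zero_iff_exists_vecMul {m : Fin ℓ → ℕ} (hm : ∀ j, 0 < m j) {lam : Fin ℓ → F}
    {v : Fin ℓ → F[X]} :
    wordOf m lam v = 0 ↔
      ∃ c, Matrix.vecMul c (Matrix.diagonal fun j => (X ^ m j - C (lam j) : F[X])) = v := by
  rw [wordOf_eq_zero_iff hm]
  constructor
  · intro h
    choose c hc using h
    refine ⟨c, funext fun j => ?_⟩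
    rw [Matrix.vecMul_diagonal, hc j, mul_comm]
  · rintro ⟨c, rfl⟩ j
    rw [Matrix.vecMul_diagonal]
    exact dvd_mul_left _ _

/-- The dimension of a code is read off from the matrix satisfying the identical equation. -/
theorem IdenticalEq.finrank_eq {m : Fin ℓ → ℕ} (hm : ∀ j, 0 < m j) {lam : Fin ℓ → F}
    {E : Submodule F (Word F m)} {A M : Matrix (Fin ℓ) (Fin ℓ) F[X]}
    (hA : IsUpper A) (hM : IsUpper M) (hE : IsGPM m lam E M) (hAM : IdenticalEq m lam A M) :
    Module.finrank F E = A.det.natDegree := by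
  have hdet : A.det * M.det ≠ 0 := by
    rw [← Matrix.det_mul, hAM]
    exact det_diagonal_X_pow_sub_C_ne_zero hm lam
  have hAd := hA.diag_ne_zero (left_ne_zero_of_mul hdet)
  have hMd := hM.diag_ne_zero (right_ne_zero_of_mul hdet)
  have hmem : ∀ c, wordOf m lam (Matrix.vecMul c M) ∈ E := fun c =>
    (isGPM_iff.1 hE _).1 ((mem_span_row_iff _ _).2 ⟨c, rfl⟩)
  -- Codewords are combinations cM modulo those with c in the row space of A; division by A leaves
  -- exactly one c with each entry of degree below the diagonal entry of A.
  let φ : (∀ j, degreeLT F (A j j).natDegree) →ₗ[F] E :=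
    { toFun := fun c => ⟨wordOf m lam (Matrix.vecMul (fun j => (c j : F[X])) M), hmem _⟩
      map_add' := fun c d => Subtype.ext <| by
        change wordOf m lam (Matrix.vecMul ((fun j => (c j : F[X])) + fun j => (d j : F[X])) M) = _
        rw [Matrix.add_vecMul, wordOf_add]
        rfl
      map_smul' := fun a c => Subtype.ext <| by
        change wordOf m lam (Matrix.vecMul (a • fun j => (c j : F[X])) M) = _
        rw [Matrix.smul_vecMul, wordOf_smul]
        rfl }
  have hdegLT : ∀ {f : F[X]} {j}, f ∈ degreeLT F (A j j).natDegree ↔ f.degree < (A j j).degree :=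
    fun {f j} => by rw [mem_degreeLT, degree_eq_natDegree (hAd j)]
  have hinj : Function.Injective φ := by
    rw [← LinearMap.ker_eq_bot, LinearMap.ker_eq_bot']
    intro c hc
    obtain ⟨a, ha⟩ := (wordOf_eq_zero_iff_exists_vecMul hm).1 (congrArg Subtype.val hc)
    rw [← hAM, ← Matrix.vecMul_vecMul] at ha
    have h1 := hM.vecMul_cancel hMd ha
    have h2 : a = 0 := hA.vecMul_injective fun j => by
      rw [h1]
      exact hdegLT.1 (c j).2
    rw [h2, Matrix.zero_vecMul] at h1
    funext j
    exact Subtype.ext (congrFun h1 j).symm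
  have hsurj : Function.Surjective φ := by
    rintro ⟨w, hw⟩
    obtain ⟨v, rfl⟩ := wordOf_surjective hm lam w
    obtain ⟨c, rfl⟩ := (mem_span_row_iff _ _).1 ((isGPM_iff.1 hE v).2 hw)
    obtain ⟨a, ha⟩ := hA.exists_degree_sub_vecMul_lt hAd c
    refine ⟨fun j => ⟨_, hdegLT.2 (ha j)⟩, Subtype.ext ?_⟩
    have h1 : wordOf m lam (Matrix.vecMul (Matrix.vecMul a A) M) = 0 := by
      rw [Matrix.vecMul_vecMul, hAM]
      exact (wordOf_eq_zero_iff_exists_vecMul hm).2 ⟨a, rfl⟩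
    have h2 : Matrix.vecMul c M =
        Matrix.vecMul (c - Matrix.vecMul a A) M + Matrix.vecMul (Matrix.vecMul a A) M := by
      rw [← Matrix.add_vecMul, sub_add_cancel]
    change wordOf m lam (Matrix.vecMul (c - Matrix.vecMul a A) M) = wordOf m lam (Matrix.vecMul c M)
    rw [h2, wordOf_add, h1, add_zero]
  rw [← (LinearEquiv.ofBijective φ ⟨hinj, hsurj⟩).finrank_eq, Module.finrank_pi_fintype, hA.det_eq,
    natDegree_prod _ _ fun j _ => hAd j]
  refine Finset.sum_congr rfl fun j _ => ?_
  rw [(degreeLTEquiv F _).finrank_eq, Module.finrank_fin_fun]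

variable {f : F →+* F} {K : Subfield F} {m : Fin ℓ → ℕ} {lam : Fin ℓ → F}
  {R E : Submodule F (Word F m)} {P Q : Matrix (Fin ℓ) (Fin ℓ) F[X]}

/-- The rows of a multiple of `P` over the fixed field lie in the largest invariant subcode. -/
theorem wordOf_mem_of_isOver (hK : ∀ x, x ∈ K ↔ f x = x) (hm : ∀ j, 0 < m j)
    (hlam : ∀ j, f (lam j) = lam j) (hE : ∀ a : Word F m, a ∈ E ↔ a ∈ R ∧ (fun s => f (a s)) ∈ R)
    (hP : IsGPM m lam R P) {Y : Matrix (Fin ℓ) (Fin ℓ) F[X]} (hY : IsOver K (Y * P)) (i : Fin ℓ) :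
    wordOf m lam ((Y * P) i) ∈ E := by
  have h1 : wordOf m lam ((Y * P) i) ∈ R :=
    (isGPM_iff.1 hP _).1 ((mem_span_row_iff _ _).2 ⟨Y i, rfl⟩)
  have h2 : (fun j => ((Y * P) i j).map f) = (Y * P) i :=
    congrFun ((isOver_iff_map_eq hK).1 hY) i
  refine (hE _).2 ⟨h1, ?_⟩
  rw [← wordOf_map f hm]
  simp only [hlam]
  rwa [h2]

/-- The largest invariant subcode of `R` has a generator matrix that comes from a factor pair. -/
theorem exists_isFactorPair_isGPM (hf : ∀ x, f (f x) = x) (hK : ∀ x, x ∈ K ↔ f x = x)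
    (hm : ∀ j, 0 < m j) (hlam : ∀ j, f (lam j) = lam j)
    (hE : ∀ a : Word F m, a ∈ E ↔ a ∈ R ∧ (fun s => f (a s)) ∈ R)
    (hP : IsReducedGPM m lam R P) (hQ : IdenticalEq m lam Q P) :
    ∃ X Y, IsFactorPair K P Q X Y ∧ IsGPM m lam E (Y * P) := by
  have hRiff := isGPM_iff.1 hP.1
  have hmap : ∀ v : Fin ℓ → F[X], (fun s => f (wordOf m lam v s)) =
      wordOf m lam fun j => (v j).map f := fun v => by
    rw [← wordOf_map f hm]
    simp only [hlam]
  -- The polynomial form of E. It is a submodule because f acts semilinearly.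
  let N : Submodule F[X] (Fin ℓ → F[X]) :=
    { carrier := {v | v ∈ Submodule.span F[X] (Set.range P.row) ∧
        (fun j => (v j).map f) ∈ Submodule.span F[X] (Set.range P.row)}
      zero_mem' := ⟨zero_mem _, by simp only [Pi.zero_apply, Polynomial.map_zero]; exact zero_mem _⟩
      add_mem' := fun {v w} hv hw => ⟨add_mem hv.1 hw.1, by
        simp only [Pi.add_apply, Polynomial.map_add]
        exact add_mem hv.2 hw.2⟩
      smul_mem' := fun a v hv => ⟨Submodule.smul_mem _ a hv.1, by
        simp only [Pi.smul_apply, smul_eq_mul, Polynomial.map_mul]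
        exact Submodule.smul_mem _ (a.map f) hv.2⟩ }
  have hN : ∀ v, v ∈ N ↔ wordOf m lam v ∈ E := fun v => by
    rw [hE, hmap, ← hRiff, ← hRiff]
    rfl
  obtain ⟨M, hMN, hM⟩ := exists_hermite N (fun j => X ^ m j - C (lam j))
    (fun j => X_pow_sub_C_ne_zero (hm j) _) fun j => by
      rw [hN, (wordOf_eq_zero_iff hm).2]
      · exact E.zero_mem
      · intro i
        rcases eq_or_ne i j with rfl | hij
        · simp
        · simp [Pi.single_eq_of_ne hij]
  have hEM : IsReducedGPM m lam E M := ⟨isGPM_iff.2 fun v => by rw [hMN, hN], hM⟩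
  have hbij : Function.Bijective f := Function.Involutive.bijective hf
  -- The involution interchanges the two conditions that define E.
  have hEf : ∀ a : Word F m, (fun s => f (a s)) ∈ E ↔ a ∈ E := fun a => by
    rw [hE, hE]
    simp only [hf]
    exact and_comm
  have hMK : IsOver K M := (isOver_iff_map_eq hK).2 ((hEM.map_eq_iff hbij hm hlam hEf).2 rfl)
  have hPd : ∀ j, P j j ≠ 0 := fun j => (hP.2.2.1 j).ne_zero
  have hMd : ∀ j, M j j ≠ 0 := fun j => (hM.2.1 j).ne_zero
  have hY : ∀ i, ∃ c, Matrix.vecMul c P = M i := fun i =>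
    (mem_span_row_iff _ _).1 (show M i ∈ N from hMN ▸ Submodule.subset_span ⟨i, rfl⟩).1
  choose Y hY using hY
  have hYP : (Matrix.of Y : Matrix (Fin ℓ) (Fin ℓ) F[X]) * P = M := by
    ext1 i j
    exact congrFun (hY i) j
  have hX : ∀ i, ∃ c, Matrix.vecMul c M =
      (Matrix.diagonal fun j => (X ^ m j - C (lam j) : F[X])) i := fun i => by
    rw [← mem_span_row_iff, isGPM_iff.1 hEM.1, (wordOf_eq_zero_iff_exists_vecMul hm).2]
    · exact E.zero_mem
    · exact ⟨Pi.single i 1, by rw [Matrix.single_one_vecMul]; rfl⟩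
  choose A hA using hX
  have hAM : IdenticalEq m lam (Matrix.of A) M := by
    ext1 i j
    exact congrFun (hA i) j
  have hdiag : IsUpper (Matrix.diagonal fun j => (X ^ m j - C (lam j) : F[X])) :=
    fun i j hj => Matrix.diagonal_apply_ne _ hj.ne'
  have hAu : IsUpper (Matrix.of A) := hM.1.of_mul hMd (by rw [hAM]; exact hdiag)
  -- Both M and the diagonal matrix are fixed by f, so f(A)M = AM, and M cancels.
  have hAK : IsOver K (Matrix.of A) := by
    rw [isOver_iff_map_eq hK]
    have h1 := hAM.map f
    simp only [hlam] at h1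
    rw [(isOver_iff_map_eq hK).1 hMK] at h1
    have h2 := h1.trans hAM.symm
    ext1 i j
    exact congrFun (hM.1.vecMul_cancel hMd (congrFun h2 i)) j
  refine ⟨Matrix.of A, Matrix.of Y, ⟨hAu, hP.2.1.of_mul hPd (hYP ▸ hM.1), hAK, hYP ▸ hMK, ?_⟩,
    hYP ▸ hEM.1⟩
  have h1 : Matrix.of A * Matrix.of Y * P = Q * P := by
    rw [Matrix.mul_assoc, hYP, hAM, hQ]
  ext1 i j
  exact congrFun (hP.2.1.vecMul_cancel hPd (congrFun h1 i)) j

theorem IsFactorPair.identicalEq {A Y : Matrix (Fin ℓ) (Fin ℓ) F[X]} (h : IsFactorPair K P Q A Y)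
    (hQ : IdenticalEq m lam Q P) : IdenticalEq m lam A (Y * P) := by
  rw [IdenticalEq, ← Matrix.mul_assoc, h.2.2.2.2]
  exact hQ

/-- Factor pairs of extremal degree give the largest invariant subcode. -/
theorem isFactorPair_extremal (hf : ∀ x, f (f x) = x) (hK : ∀ x, x ∈ K ↔ f x = x)
    (hm : ∀ j, 0 < m j) (hlam : ∀ j, f (lam j) = lam j)
    (hE : ∀ a : Word F m, a ∈ E ↔ a ∈ R ∧ (fun s => f (a s)) ∈ R)
    (hP : IsReducedGPM m lam R P) (hQ : IdenticalEq m lam Q P)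
    {A Y : Matrix (Fin ℓ) (Fin ℓ) F[X]} (h : IsFactorPair K P Q A Y) :
    ((∀ A' Y', IsFactorPair K P Q A' Y' → A'.det.natDegree ≤ A.det.natDegree) ↔
      (∀ A' Y', IsFactorPair K P Q A' Y' → Y.det.natDegree ≤ Y'.det.natDegree)) ∧
    ((∀ A' Y', IsFactorPair K P Q A' Y' → A'.det.natDegree ≤ A.det.natDegree) →
      IsMT m lam E ∧ IsGPM m lam E (Y * P) ∧ Module.finrank F E = A.det.natDegree ∧
        IdenticalEq m lam A (Y * P)) := by
  have hQdet : Q.det ≠ 0 := by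
    have h1 : Q.det * P.det ≠ 0 := by
      rw [← Matrix.det_mul, hQ]
      exact det_diagonal_X_pow_sub_C_ne_zero hm lam
    exact left_ne_zero_of_mul h1
  have hne : ∀ {A' Y'}, IsFactorPair K P Q A' Y' → A'.det ≠ 0 ∧ Y'.det ≠ 0 := fun {A' Y'} h' => by
    rw [← h'.2.2.2.2, Matrix.det_mul] at hQdet
    exact ⟨left_ne_zero_of_mul hQdet, right_ne_zero_of_mul hQdet⟩
  have hsum : ∀ {A' Y'}, IsFactorPair K P Q A' Y' →
      A'.det.natDegree + Y'.det.natDegree = Q.det.natDegree := fun {A' Y'} h' => by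
    rw [← natDegree_mul (hne h').1 (hne h').2, ← Matrix.det_mul, h'.2.2.2.2]
  have hid := h.identicalEq hQ
  have hmul := IsUpper.mul h.2.1 hP.2.1
  refine ⟨⟨fun hmax A' Y' h' => ?_, fun hmin A' Y' h' => ?_⟩, fun hmax => ?_⟩
  · have := hmax A' Y' h'
    have := hsum h
    have := hsum h'
    omega
  · have := hmin A' Y' h'
    have := hsum h
    have := hsum h'
    omega
  · obtain ⟨A₀, Y₀, h₀, hE₀⟩ := exists_isFactorPair_isGPM hf hK hm hlam hE hP hQ
    have hZ : ∀ i, ∃ c, Matrix.vecMul c (Y₀ * P) = (Y * P) i := fun i =>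
      (mem_span_row_iff _ _).1 <| (isGPM_iff.1 hE₀ _).2 <|
        wordOf_mem_of_isOver hK hm hlam hE hP.1 h.2.2.2.1 i
    choose Z hZ using hZ
    have hZmul : (Matrix.of Z : Matrix (Fin ℓ) (Fin ℓ) F[X]) * (Y₀ * P) = Y * P := by
      ext1 i j
      exact congrFun (hZ i) j
    set Z' : Matrix (Fin ℓ) (Fin ℓ) F[X] := Matrix.of Z with hZ'
    have hPdet : P.det ≠ 0 := by
      rw [hP.2.1.det_eq]
      exact Finset.prod_ne_zero_iff.2 fun j _ => (hP.2.2.1 j).ne_zero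
    have hZdet : Z'.det * Y₀.det = Y.det := by
      have h1 := congrArg Matrix.det hZmul
      rw [Matrix.det_mul, Matrix.det_mul, Matrix.det_mul, ← mul_assoc] at h1
      exact mul_right_cancel₀ hPdet h1
    -- Maximality and the constant degree sum give deg det Y ≤ deg det Y₀, while det Y = det Z' ·
    -- det Y₀.
    have hZunit : IsUnit Z'.det := by
      have hZ0 : Z'.det ≠ 0 := fun h0 => (hne h).2 (by rw [← hZdet, h0, zero_mul])
      have h1 := natDegree_mul hZ0 (hne h₀).2
      rw [hZdet] at h1
      have h2 := hmax _ _ h₀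
      have h3 := hsum h
      have h4 := hsum h₀
      rw [Polynomial.isUnit_iff_degree_eq_zero, degree_eq_natDegree hZ0]
      have h5 : Z'.det.natDegree = 0 := by omega
      rw [h5]
      rfl
    have hGPM : IsGPM m lam E (Y * P) := by
      rw [isGPM_iff]
      intro v
      rw [← isGPM_iff.1 hE₀, mem_span_row_iff, mem_span_row_iff]
      constructor
      · rintro ⟨c, rfl⟩
        exact ⟨Matrix.vecMul c Z', by rw [Matrix.vecMul_vecMul, hZmul]⟩
      · rintro ⟨c, rfl⟩
        refine ⟨Matrix.vecMul c Z'⁻¹, ?_⟩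
        rw [← hZmul, Matrix.vecMul_vecMul, ← Matrix.mul_assoc, Matrix.nonsing_inv_mul _ hZunit,
          Matrix.one_mul]
    exact ⟨hGPM.isMT hm, hGPM, hid.finrank_eq hm h.1 hmul hGPM, hid⟩

end Factorization

end MultiTwisted

namespace MultiTwisted

/-! ### Galois duals through Euclidean duals, and fixed fields of Frobenius powers. -/

section Frobenius

variable {F : Type*} [Field F] {ℓ : ℕ} {m : Fin ℓ → ℕ}

theorem euclideanDual_euclideanDual (D : Submodule F (Word F m)) :
    euclideanDual (euclideanDual D) = D := by
  classical
  let B : LinearMap.BilinForm F (Word F m) := dotProductBilin F F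
  have hB : ∀ a b, B a b = ∑ s, a s * b s := fun _ _ => rfl
  have hrefl : B.IsRefl := fun a b h => by
    rw [hB] at h ⊢
    simpa only [mul_comm] using h
  have hnd : B.Nondegenerate := by
    refine hrefl.nondegenerate_iff_separatingLeft.2 fun a ha => ?_
    funext s
    have := ha (Pi.single s 1)
    rw [hB] at this
    simpa [Pi.single_apply] using this
  have hdual : ∀ D : Submodule F (Word F m), euclideanDual D = B.orthogonal D := fun D => by
    ext a
    rw [LinearMap.BilinForm.mem_orthogonal_iff]
    refine forall₂_congr fun c _ => ?_
    rw [hB]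
    simp only [mul_comm]
  rw [hdual, hdual, LinearMap.BilinForm.orthogonal_orthogonal hnd hrefl]

/-- The words whose image under the coefficientwise action of `f` lies in `D`. -/
def comapWord (f : F →+* F) (D : Submodule F (Word F m)) : Submodule F (Word F m) where
  carrier := {a | (fun s => f (a s)) ∈ D}
  zero_mem' := by
    simp only [Set.mem_ofPred_eq, Pi.zero_apply, map_zero]
    exact D.zero_mem
  add_mem' := fun {a b} ha hb => by
    simp only [Set.mem_ofPred_eq, Pi.add_apply, map_add]
    exact D.add_mem ha hb
  smul_mem' := fun r a ha => by
    simp only [Set.mem_ofPred_eq, Pi.smul_apply, smul_eq_mul, map_mul]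
    exact D.smul_mem (f r) ha

theorem mem_comapWord {f : F →+* F} {D : Submodule F (Word F m)} {a : Word F m} :
    a ∈ comapWord f D ↔ (fun s => f (a s)) ∈ D := Iff.rfl

/-- Applying f or its inverse g to an inner product carries one orthogonality relation to the other.
-/
theorem euclideanDual_comapWord {f g : F →+* F} (hfg : ∀ x, f (g x) = x) (hgf : ∀ x, g (f x) = x)
    (D : Submodule F (Word F m)) :
    euclideanDual (comapWord f D) = comapWord f (euclideanDual D) := by
  ext a
  constructor
  · intro h c hc
    have h1 := h (fun s => g (c s)) (by rw [mem_comapWord]; simpa only [hfg] using hc)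
    have h2 := congrArg f h1
    simpa only [map_sum, map_mul, hfg, map_zero] using h2
  · intro h c hc
    have h1 := congrArg g (h _ hc)
    simpa only [map_sum, map_mul, hgf, map_zero] using h1

/-- A code is invariant under an involution if and only if its Euclidean dual is. -/
theorem comapWord_euclideanDual_eq_iff {f : F →+* F} (hf : ∀ x, f (f x) = x)
    (D : Submodule F (Word F m)) :
    comapWord f (euclideanDual D) = euclideanDual D ↔ comapWord f D = D := by
  rw [← euclideanDual_comapWord hf hf]
  exact (Function.LeftInverse.injective euclideanDual_euclideanDual).eq_iff

variable (p : ℕ) [ExpChar F p]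

theorem iterateFrobenius_mul_eq_self [Finite F] {e : ℕ} (hF : Nat.card F = p ^ e) (k : ℕ) (x : F) :
    iterateFrobenius F p (e * k) x = x := by
  have := Fintype.ofFinite F
  rw [iterateFrobenius_def, pow_mul, ← hF, Nat.card_eq_fintype_card]
  exact FiniteField.pow_card_pow k x

/-- For an involution, image and preimage coincide. -/
theorem image_frobWord_eq_iff {μ : ℕ}
    (hf : ∀ x : F, iterateFrobenius F p μ (iterateFrobenius F p μ x) = x)
    (D : Submodule F (Word F m)) :
    frobWord p μ '' (D : Set (Word F m)) = D ↔ comapWord (iterateFrobenius F p μ) D = D := by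
  have h : frobWord p μ '' (D : Set (Word F m)) = comapWord (iterateFrobenius F p μ) D := by
    ext a
    constructor
    · rintro ⟨b, hb, rfl⟩
      change (fun s => _) ∈ D
      simp only [frobWord, hf]
      exact hb
    · intro ha
      exact ⟨_, ha, by funext s; simp only [frobWord, hf]⟩
  rw [h, SetLike.coe_set_eq]

theorem rightDual_eq (κ : ℕ) (D : Submodule F (Word F m)) :
    rightDual p κ D = comapWord (iterateFrobenius F p κ) (euclideanDual D) := by
  ext a
  refine forall₂_congr fun c _ => ?_
  simp only [galoisInner, mul_comm]

/-- Applying g to ⟨a, c⟩_κ strips σ^κ from c and moves the twist onto a. -/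
theorem leftDual_eq {κ : ℕ} {g : F →+* F} (hg : ∀ x, g (iterateFrobenius F p κ x) = x)
    (D : Submodule F (Word F m)) : leftDual p κ D = comapWord g (euclideanDual D) := by
  ext a
  refine forall₂_congr fun c _ => ?_
  rw [← map_eq_zero_iff g g.injective, galoisInner, map_sum]
  simp only [map_mul, hg]

/-- A subfield of order `p ^ gcd (e, k)` is the fixed field of the `k`-th power of Frobenius. -/
theorem mem_subfield_iff_iterateFrobenius_eq [Finite F] [Fact p.Prime] {e k : ℕ} (he : 0 < e)
    (hF : Nat.card F = p ^ e) (K : Subfield F) (hK : Nat.card K = p ^ Nat.gcd e k) (x : F) :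
    x ∈ K ↔ iterateFrobenius F p k x = x := by
  have hg : Nat.gcd e k ≠ 0 := (Nat.gcd_pos_of_pos_left k he).ne'
  have hper : ∀ n, (frobenius F p)^[n] x = iterateFrobenius F p n x := fun n => by
    rw [coe_iterateFrobenius]
  have hKfix : ∀ y ∈ K, y ^ p ^ Nat.gcd e k = y := fun y hy => by
    have := Fintype.ofFinite K
    have h := FiniteField.pow_card (⟨y, hy⟩ : K)
    rw [← Nat.card_eq_fintype_card, hK] at h
    exact congrArg Subtype.val h
  constructor
  · intro hx
    have h1 : Function.IsPeriodicPt (frobenius F p) (Nat.gcd e k) x := by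
      rw [Function.IsPeriodicPt, Function.IsFixedPt, hper, iterateFrobenius_def]
      exact hKfix x hx
    rw [← hper]
    exact h1.trans_dvd (Nat.gcd_dvd_right e k)
  · intro hx
    -- Both e and k are periods of x under Frobenius, hence so is their gcd.
    have h1 : Function.IsPeriodicPt (frobenius F p) (Nat.gcd e k) x := by
      refine Function.IsPeriodicPt.gcd ?_ ?_
      · rw [Function.IsPeriodicPt, Function.IsFixedPt, hper]
        simpa using iterateFrobenius_mul_eq_self p hF 1 x
      · rw [Function.IsPeriodicPt, Function.IsFixedPt, hper]
        exact hx
    rw [Function.IsPeriodicPt, Function.IsFixedPt, hper, iterateFrobenius_def] at h1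
    classical
    have hp : 1 < p := (Fact.out : p.Prime).one_lt
    -- This polynomial has at most p^gcd roots and K already supplies that many, so x lies in K.
    set q : F[X] := X ^ p ^ Nat.gcd e k - X with hq
    have hq0 : q ≠ 0 := FiniteField.X_pow_card_pow_sub_X_ne_zero F hg hp
    have hroot : ∀ y : F, y ∈ q.roots.toFinset ↔ y ^ p ^ Nat.gcd e k = y := fun y => by
      rw [Multiset.mem_toFinset, mem_roots hq0, IsRoot.def, hq, eval_sub, eval_pow, eval_X,
        sub_eq_zero]
    have hsub : (K : Set F) ⊆ q.roots.toFinset := fun y hy => (hroot y).2 (hKfix y hy)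
    have hcard : (q.roots.toFinset : Set F).ncard ≤ (K : Set F).ncard := by
      rw [Set.ncard_coe_finset]
      have h2 : (K : Set F).ncard = p ^ Nat.gcd e k := hK
      rw [h2]
      refine (Multiset.toFinset_card_le _).trans ((card_roots' q).trans ?_)
      rw [FiniteField.X_pow_card_pow_sub_X_natDegree_eq F hg hp]
    have heq := Set.eq_of_subset_of_ncard_le hsub hcard
    have hxr : x ∈ (q.roots.toFinset : Set F) := (hroot x).2 h1
    rw [← heq] at hxr
    exact hxr

end Frobenius

end MultiTwisted

/-! ### The main theorem. -/

theorem mainTheorem2 {F : Type*} [Field F] [Finite F] (p e κ : ℕ) [Fact p.Prime] [CharP F p]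
    (hF : Nat.card F = p ^ e) (hκ : κ < e) (hdvd : e ∣ 4 * κ)
    (K : Subfield F) (hK : Nat.card K = p ^ Nat.gcd e (2 * κ))
    {ℓ : ℕ} (m : Fin ℓ → ℕ) (hm : ∀ j, 0 < m j)
    (lam : Fin ℓ → F) (hlam : ∀ j, lam j ≠ 0) (hlamK : ∀ j, lam j ∈ K)
    (C : Submodule F (MultiTwisted.Word F m)) (hC : MultiTwisted.IsMT m lam C)
    (G H B : Matrix (Fin ℓ) (Fin ℓ) (Polynomial F))
    (hG : MultiTwisted.IsReducedGPM m lam C G)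
    (hH : MultiTwisted.IsReducedGPM m (fun j => (lam j)⁻¹) (MultiTwisted.euclideanDual C) H)
    (hB : MultiTwisted.IdenticalEq m (fun j => (lam j)⁻¹) B H) :
    ((MultiTwisted.rightDual p κ C = MultiTwisted.leftDual p κ C ↔
        MultiTwisted.frobWord p (2 * κ) '' (C : Set (MultiTwisted.Word F m)) = C) ∧
      (MultiTwisted.frobWord p (2 * κ) '' (C : Set (MultiTwisted.Word F m)) = C ↔
        MultiTwisted.IsOver K G)) ∧
    ∀ X Y : Matrix (Fin ℓ) (Fin ℓ) (Polynomial F),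
      MultiTwisted.IsFactorPair K (MultiTwisted.frobMatrix p (e - κ) H)
          (MultiTwisted.frobMatrix p (e - κ) B) X Y →
        ((∀ X' Y', MultiTwisted.IsFactorPair K (MultiTwisted.frobMatrix p (e - κ) H)
              (MultiTwisted.frobMatrix p (e - κ) B) X' Y' →
              X'.det.natDegree ≤ X.det.natDegree) ↔
          (∀ X' Y', MultiTwisted.IsFactorPair K (MultiTwisted.frobMatrix p (e - κ) H)
              (MultiTwisted.frobMatrix p (e - κ) B) X' Y' →
              Y.det.natDegree ≤ Y'.det.natDegree)) ∧
        ((∀ X' Y', MultiTwisted.IsFactorPair K (MultiTwisted.frobMatrix p (e - κ) H)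
              (MultiTwisted.frobMatrix p (e - κ) B) X' Y' →
              X'.det.natDegree ≤ X.det.natDegree) →
          MultiTwisted.IsMT m (fun j => iterateFrobenius F p (e - κ) (lam j)⁻¹)
              (MultiTwisted.rightDual p κ C ⊓ MultiTwisted.leftDual p κ C) ∧
          MultiTwisted.IsGPM m (fun j => iterateFrobenius F p (e - κ) (lam j)⁻¹)
              (MultiTwisted.rightDual p κ C ⊓ MultiTwisted.leftDual p κ C)
              (Y * MultiTwisted.frobMatrix p (e - κ) H) ∧
          Module.finrank F
              ↥(MultiTwisted.rightDual p κ C ⊓ MultiTwisted.leftDual p κ C) =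
            X.det.natDegree ∧
          MultiTwisted.IdenticalEq m (fun j => iterateFrobenius F p (e - κ) (lam j)⁻¹) X
              (Y * MultiTwisted.frobMatrix p (e - κ) H)) := by
  have hσ : ∀ a b (x : F), iterateFrobenius F p a (iterateFrobenius F p b x) =
      iterateFrobenius F p (a + b) x := fun a b x => (iterateFrobenius_add_apply F p a b x).symm
  have hσe : ∀ (k n) (x : F), n = e * k → iterateFrobenius F p n x = x := fun k n x h =>
    h ▸ MultiTwisted.iterateFrobenius_mul_eq_self p hF k x
  obtain ⟨k, hk⟩ := hdvd
  have hf : ∀ x : F, iterateFrobenius F p (2 * κ) (iterateFrobenius F p (2 * κ) x) = x :=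
    fun x => by rw [hσ]; exact hσe k _ x (by omega)
  have hbij : ∀ n, Function.Bijective (iterateFrobenius F p n) := fun n =>
    Finite.injective_iff_bijective.1 (iterateFrobenius F p n).injective
  have hKf := MultiTwisted.mem_subfield_iff_iterateFrobenius_eq p (Nat.zero_lt_of_lt hκ) hF K hK
  set D := MultiTwisted.euclideanDual C with hD
  set R := MultiTwisted.rightDual p κ C with hR
  set L := MultiTwisted.leftDual p κ C with hL
  have hRmem : ∀ a, a ∈ R ↔ (fun s => iterateFrobenius F p κ (a s)) ∈ D := fun a => by
    rw [hR, MultiTwisted.rightDual_eq]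
    rfl
  have hLmem : ∀ a, a ∈ L ↔ (fun s => iterateFrobenius F p (2 * κ) (a s)) ∈ R := fun a => by
    -- σ^{3κ} inverts σ^κ because e ∣ 4κ, and it splits as σ^κ after σ^{2κ}.
    rw [hRmem, hL, MultiTwisted.leftDual_eq p (g := iterateFrobenius F p (κ + 2 * κ))
      fun x => by rw [hσ]; exact hσe k _ x (by omega)]
    simp only [hσ]
    rfl
  -- Since σ^κ σ^{e-κ} = σ^e = 1, σ^{e-κ} carries C^⊥ onto R, and so H and B to the matrices for R.
  have hDR : ∀ a : MultiTwisted.Word F m,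
      (fun s => iterateFrobenius F p (e - κ) (a s)) ∈ R ↔ a ∈ D := fun a => by
    have h1 : ∀ x : F, iterateFrobenius F p (κ + (e - κ)) x = x := fun x =>
      hσe 1 _ x (by omega)
    rw [hRmem]
    simp only [hσ, h1]
  refine ⟨⟨?_, ?_⟩, fun X Y hXY => ?_⟩
  · rw [MultiTwisted.image_frobWord_eq_iff p hf, ← MultiTwisted.comapWord_euclideanDual_eq_iff hf,
      ← hD]
    constructor
    · intro h
      ext a
      -- Membership in C^⊥ is tested in R through σ^{e-κ}, which commutes with σ^{2κ}.
      rw [MultiTwisted.mem_comapWord, ← hDR, ← hDR]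
      simp only [hσ, add_comm (e - κ) (2 * κ)]
      simp only [← hσ]
      rw [← hLmem, ← h]
    · intro h
      ext a
      rw [hLmem, hRmem, hRmem]
      simp only [hσ, add_comm κ (2 * κ)]
      simp only [← hσ]
      exact (SetLike.ext_iff.1 h fun s => iterateFrobenius F p κ (a s)).symm
  · rw [MultiTwisted.image_frobWord_eq_iff p hf, MultiTwisted.isOver_iff_map_eq hKf]
    exact (hG.map_eq_iff (hbij _) hm (fun j => (hKf _).1 (hlamK j)) fun a => by
      rw [MultiTwisted.mem_comapWord]
      simp only [hf]).symm
  · refine MultiTwisted.isFactorPair_extremal hf hKf hm (fun j => ?_) (fun a => ?_)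
      (hH.map (hbij (e - κ)) hm hDR) (hB.map _) hXY
    · rw [hσ, add_comm, ← hσ, (hKf _).1 (K.inv_mem (hlamK j))]
    · rw [Submodule.mem_inf, hLmem]
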